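/- Let $A, \hat A \in \mathbb{C}^{n\times n}$ be positive-semidefinite matrices, let $b, x_0 \in \mathbb{C}^n$, and let $M^+$ denote the Moore--Penrose pseudoinverse of $M$. Write $\|v\|_A = (v^* A v)^{1/2}$. The Kaporin condition number of $A$ and $\hat A$ is $$\kappa_{\rm Kap} = \frac{\bigl(\tfrac1r \operatorname{tr}(A\hat A^+)\bigr)^r}{\operatorname{vol}(A\hat A^+)}, \qquad r = \operatorname{rank}(A),$$ if $A$ and $\hat A$ have the same range, and $\kappa_{\rm Kap} = \infty$ otherwise; here $\operatorname{vol}$ is the product of the positive eigenvalues, counted with multiplicity (and $\kappa_{\rm Kap}=1$ if $A=\hat A=0$). Preconditioned conjugate gradient (PCG) with preconditioner $\hat A$ starts from $r_0 = b - A x_0$, $d_1 = \hat A^+ r_0$ and computes, for $t = 1, 2, \ldots$, $$x_t = x_{t-1} + \alpha_t d_t, \quad r_t = r_{t-1} - \alpha_t A d_t, \quad \alpha_t = \frac{r_{t-1}^* \hat A^+ r_{t-1}}{d_t^* A d_t}, \quad d_{t+1} = \hat A^+ r_t + \frac{r_t^* \hat A^+ r_t}{r_{t-1}^* \hat A^+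 r_{t-1}}\, d_t,$$ where a quotient with denominator zero is read as $0$. Then $x_\star = A^+ b$ is the (unique) minimum-norm solution of the least-squares problem $\min_x \|Ax - b\|^2$, where $\|\cdot\|$ is the Euclidean norm, and for every integer $t \ge 0$, even or odd, the PCG iterates satisfy $$\frac{\|x_t - x_\star\|_A^2}{\|x_0 - x_\star\|_A^2} \le \Bigl(\frac{3 \log \kappa_{\rm Kap}}{t}\Bigr)^t .$$ The ratio on the left is read as $0$ if both its terms are zero and as $\infty$ if only the denominator is zero; the right-hand side is read as $1$ if $t = 0$ and as $\infty$ if $t \ge 1$ and $\kappa_{\rm Kap} = \infty$. -/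

import Mathlib

open Matrix

open scoped ENNReal ComplexOrder

namespace KaporinPCG

/-- The four Penrose equations: `X` is the Moore-Penrose pseudoinverse of `A`. -/
structure IsMoorePenroseInverse {m n : ℕ} (A : Matrix (Fin m) (Fin n) ℂ)
    (X : Matrix (Fin n) (Fin m) ℂ) : Prop where
  mul_mul_self : A * X * A = A
  mul_mul_inv : X * A * X = X
  isHermitian_left : (A * X).IsHermitian
  isHermitian_right : (X * A).IsHermitian

/-- A Hermitian matrix has a Hermitian commuting generalized inverse, obtained by inverting the
nonzero eigenvalues. -/
theorem exists_group_inverse {n : ℕ} {H : Matrix (Fin n) (Fin n) ℂ} (hH : H.IsHermitian) :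
    ∃ Y : Matrix (Fin n) (Fin n) ℂ,
      Y.IsHermitian ∧ Y * H = H * Y ∧ Y * H * Y = Y ∧ H * Y * H = H := by
  set U : Matrix (Fin n) (Fin n) ℂ := (hH.eigenvectorUnitary : Matrix (Fin n) (Fin n) ℂ) with hU
  have hUU : Uᴴ * U = 1 := by
    have := hH.eigenvectorUnitary.2
    exact (Matrix.mem_unitaryGroup_iff'.1 this)
  have hspec : H = U * diagonal (fun i => (hH.eigenvalues i : ℂ)) * Uᴴ := by
    have h := hH.spectral_theorem
    rw [Unitary.conjStarAlgAut_apply] at h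
    exact h
  set L : Matrix (Fin n) (Fin n) ℂ := diagonal (fun i => (hH.eigenvalues i : ℂ)) with hL
  set M : Matrix (Fin n) (Fin n) ℂ := diagonal (fun i => (hH.eigenvalues i : ℂ)⁻¹) with hM
  have key : ∀ P Q : Matrix (Fin n) (Fin n) ℂ, U * P * Uᴴ * (U * Q * Uᴴ) = U * (P * Q) * Uᴴ := by
    intro P Q
    calc U * P * Uᴴ * (U * Q * Uᴴ) = U * P * (Uᴴ * U) * Q * Uᴴ := by
          simp only [Matrix.mul_assoc]
      _ = U * (P * Q) * Uᴴ := by rw [hUU, Matrix.mul_one]; simp only [Matrix.mul_assoc]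
  refine ⟨U * M * Uᴴ, ?_, ?_, ?_, ?_⟩
  · refine Matrix.isHermitian_mul_mul_conjTranspose U ?_
    rw [hM, Matrix.IsHermitian, diagonal_conjTranspose]
    congr 1
    ext i
    rw [Pi.star_apply, star_inv₀, Complex.star_def, Complex.conj_ofReal]
  · rw [hspec, key, key, hL, hM, diagonal_mul_diagonal, diagonal_mul_diagonal]
    congr 4
    ext i
    ring
  · have h : M * L * M = M := by
      rw [hL, hM, diagonal_mul_diagonal, diagonal_mul_diagonal]
      refine congrArg diagonal (funext fun i => ?_)
      rcases eq_or_ne (hH.eigenvalues i : ℂ) 0 with h0 | h0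
      · rw [h0]; ring
      · field_simp
    rw [hspec, key, key, h]
  · have h : L * M * L = L := by
      rw [hL, hM, diagonal_mul_diagonal, diagonal_mul_diagonal]
      refine congrArg diagonal (funext fun i => ?_)
      rcases eq_or_ne (hH.eigenvalues i : ℂ) 0 with h0 | h0
      · rw [h0]; ring
      · field_simp
    rw [hspec, key, key, h]

theorem exists_isMoorePenroseInverse {m n : ℕ} (A : Matrix (Fin m) (Fin n) ℂ) :
    ∃ X : Matrix (Fin n) (Fin m) ℂ, IsMoorePenroseInverse A X := by
  have hH : (Aᴴ * A).IsHermitian := Matrix.isHermitian_conjTranspose_mul_self A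
  obtain ⟨Y, hY, hc, h1, h2⟩ := exists_group_inverse hH
  have hA : A * Y * (Aᴴ * A) = A := by
    have h0 : A * (1 - Y * (Aᴴ * A)) = 0 := by
      rw [← Matrix.conjTranspose_mul_self_eq_zero, Matrix.conjTranspose_mul]
      have : Aᴴ * (A * (1 - Y * (Aᴴ * A))) = 0 := by
        have : Aᴴ * (A * (1 - Y * (Aᴴ * A))) = Aᴴ * A - Aᴴ * A * Y * (Aᴴ * A) := by
          simp only [Matrix.mul_sub, Matrix.mul_one, Matrix.mul_assoc]
        rw [this, h2, sub_self]
      rw [Matrix.mul_assoc, this, Matrix.mul_zero]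
    rw [Matrix.mul_sub, Matrix.mul_one, sub_eq_zero] at h0
    rw [Matrix.mul_assoc]
    exact h0.symm
  refine ⟨Y * Aᴴ, ?_, ?_, ?_, ?_⟩
  · rw [← Matrix.mul_assoc, Matrix.mul_assoc (A * Y)]
    exact hA
  · calc Y * Aᴴ * A * (Y * Aᴴ) = Y * (Aᴴ * A) * Y * Aᴴ := by simp only [Matrix.mul_assoc]
      _ = Y * Aᴴ := by rw [h1]
  · rw [← Matrix.mul_assoc]
    exact Matrix.isHermitian_mul_mul_conjTranspose A hY
  · rw [Matrix.IsHermitian, Matrix.mul_assoc, Matrix.conjTranspose_mul, hY, hH, hc]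

theorem IsMoorePenroseInverse.unique {m n : ℕ} {A : Matrix (Fin m) (Fin n) ℂ}
    {X Y : Matrix (Fin n) (Fin m) ℂ} (hX : IsMoorePenroseInverse A X)
    (hY : IsMoorePenroseInverse A Y) : X = Y := by
  have h1 : A * X = A * Y := by
    calc A * X = A * Y * (A * X) := by
          rw [← Matrix.mul_assoc, hY.mul_mul_self]
      _ = (A * X * (A * Y))ᴴ := by
          rw [Matrix.conjTranspose_mul, hX.isHermitian_left, hY.isHermitian_left]
      _ = A * Y := by
          rw [← Matrix.mul_assoc, hX.mul_mul_self, hY.isHermitian_left]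
  have h2 : X * A = Y * A := by
    calc X * A = X * A * (Y * A) := by
          rw [Matrix.mul_assoc, ← Matrix.mul_assoc A Y, hY.mul_mul_self]
      _ = (Y * A * (X * A))ᴴ := by
          rw [Matrix.conjTranspose_mul, hX.isHermitian_right, hY.isHermitian_right]
      _ = Y * A := by
          rw [Matrix.mul_assoc, ← Matrix.mul_assoc A X, hX.mul_mul_self, hY.isHermitian_right]
  rw [← hX.mul_mul_inv, h2, Matrix.mul_assoc, h1, ← Matrix.mul_assoc, hY.mul_mul_inv]

/-- The Moore-Penrose pseudoinverse `A⁺`. -/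
noncomputable def pinv {m n : ℕ} (A : Matrix (Fin m) (Fin n) ℂ) : Matrix (Fin n) (Fin m) ℂ :=
  (exists_isMoorePenroseInverse A).choose

theorem isMoorePenroseInverse_pinv {m n : ℕ} (A : Matrix (Fin m) (Fin n) ℂ) :
    IsMoorePenroseInverse A (pinv A) :=
  (exists_isMoorePenroseInverse A).choose_spec

open Classical in
/-- The volume: the product of the positive eigenvalues, counted with (algebraic) multiplicity. -/
noncomputable def vol {n : ℕ} (M : Matrix (Fin n) (Fin n) ℂ) : ℝ :=
  ((M.charpoly.roots.filter (fun z => z.im = 0 ∧ 0 < z.re)).map Complex.re).prod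

open Classical in
/-- The Kaporin condition number `((1/r) tr (A Â⁺))^r / vol (A Â⁺)`, `r = rank A`, of a
positive-semidefinite matrix `A` and a positive-semidefinite approximation `Â`; it is `∞` if the
ranges differ. For such matrices the trace is a (nonnegative) real number. -/
noncomputable def kaporin {n : ℕ} (A Ahat : Matrix (Fin n) (Fin n) ℂ) : ℝ≥0∞ :=
  if LinearMap.range A.mulVecLin = LinearMap.range Ahat.mulVecLin then
    ENNReal.ofReal
      ((1 / (A.rank : ℝ) * (A * pinv Ahat).trace.re) ^ A.rank / vol (A * pinv Ahat))
  else ⊤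

/-- The `A`-weighted (semi)norm `‖v‖_A = (v^* A v)^{1/2}`. -/
noncomputable def weightedNorm {n : ℕ} (A : Matrix (Fin n) (Fin n) ℂ) (v : Fin n → ℂ) : ℝ :=
  Real.sqrt (star v ⬝ᵥ (A *ᵥ v)).re

/-- The data carried by preconditioned conjugate gradient after `t` iterations: the iterate
`x = x_t`, the residual `r = r_t` and the next search direction `d = d_{t+1}`. -/
structure PCGState (n : ℕ) where
  x : Fin n → ℂ
  r : Fin n → ℂ
  d : Fin n → ℂ

/-- One iteration of preconditioned conjugate gradient. The convention `a / 0 = 0` makes the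
iteration stationary once it has converged exactly (preconditioned residual zero). -/
noncomputable def pcgStep {n : ℕ} (A Ahat : Matrix (Fin n) (Fin n) ℂ) (s : PCGState n) :
    PCGState n :=
  let α : ℂ := (star s.r ⬝ᵥ (pinv Ahat *ᵥ s.r)) / (star s.d ⬝ᵥ (A *ᵥ s.d))
  let r' : Fin n → ℂ := s.r - α • (A *ᵥ s.d)
  let β : ℂ := (star r' ⬝ᵥ (pinv Ahat *ᵥ r')) / (star s.r ⬝ᵥ (pinv Ahat *ᵥ s.r))
  { x := s.x + α • s.d
    r := r'
    d := pinv Ahat *ᵥ r' + β • s.d }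

/-- Preconditioned conjugate gradient for `A x = b` with preconditioner `Ahat` and initial guess
`x₀`. -/
noncomputable def pcg {n : ℕ} (A Ahat : Matrix (Fin n) (Fin n) ℂ) (b x₀ : Fin n → ℂ) :
    ℕ → PCGState n
  | 0 => { x := x₀, r := b - A *ᵥ x₀, d := pinv Ahat *ᵥ (b - A *ᵥ x₀) }
  | t + 1 => pcgStep A Ahat (pcg A Ahat b x₀ t)

/-- `x` minimizes `‖A x - b‖` (Euclidean norm). -/
def IsLeastSquaresSolution {n : ℕ} (A : Matrix (Fin n) (Fin n) ℂ) (b x : Fin n → ℂ) : Prop :=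
  ∀ y : Fin n → ℂ, ‖WithLp.toLp 2 (A *ᵥ x - b)‖ ≤ ‖WithLp.toLp 2 (A *ᵥ y - b)‖

/-- `x` is the (unique) least-squares solution of smallest Euclidean norm. -/
def IsMinNormLeastSquaresSolution {n : ℕ} (A : Matrix (Fin n) (Fin n) ℂ) (b x : Fin n → ℂ) :
    Prop :=
  IsLeastSquaresSolution A b x ∧
    ∀ y : Fin n → ℂ, IsLeastSquaresSolution A b y → y ≠ x →
      ‖WithLp.toLp 2 x‖ < ‖WithLp.toLp 2 y‖

end KaporinPCG

namespace KaporinPCG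

/-! ### Polynomials small on a finite set of positive numbers -/

/-! Optimality: the PCG residual is orthogonal to the Krylov space of `Â⁺A`, so the error is at most
`‖p(Â⁺A)(x₀ - x⋆)‖_A` for every real polynomial `p` of degree at most `t` with `p(0) = 1`
(`weightedNorm_pcg_le_aeval`). Symmetrization: with `A = RᴴR` and `B = R Â⁺ Rᴴ`, the relation `R
p(Â⁺A) = p(B) R` reduces the bound to the size of `p²` on the positive eigenvalues of `B`, and these
are the numbers from which `κ` is formed (`kaporinReal_eq`).

It remains to choose `p` (`exists_polynomial_sq_le_prod`). Let `a < b` be the extreme eigenvalues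
and `q = ((a + b)/2)²/(ab)`. The quadratic `(1 - x/a)(1 - x/b)` vanishes at both and has modulus at
most `q - 1` between them. Remove `a` and `b` and repeat; an odd `t` ends with `1 - 2x/(a + b)`,
whose square is at most `q - 1`. Replacing a used pair by two copies of its mean keeps the sum and
multiplies the product by `q`, so AM-GM bounds the product of all used ratios by `κ`. Listing `q`
twice for a quadratic and once for a linear factor gives `t` numbers with product at most `κ²`, and
`p² ≤ ∏ (q_j - 1) ≤ (κ^(2/t) - 1)^t` (`prod_sub_one_le_pow`). Finally `exp (2x) - 1 ≤ 3x` for `x =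
log κ / t ≤ 1/3`; for larger `x` the constant `p = 1` suffices. -/

theorem prod_sub_one_le_pow {t : ℕ} (ht : 0 < t) {q : Fin t → ℝ} (hq : ∀ j, 1 ≤ q j) {D : ℝ}
    (hD : ∏ j, q j ≤ D) : ∏ j, (q j - 1) ≤ (D ^ (1 / t : ℝ) - 1) ^ t := by
  have ht' : (0 : ℝ) < t := by exact_mod_cast ht
  have hq0 : ∀ j, 0 < q j := fun j => lt_of_lt_of_le one_pos (hq j)
  have hP : 0 < ∏ j, q j := Finset.prod_pos fun j _ => hq0 j
  have hE : 0 ≤ ∏ j, (q j - 1) := Finset.prod_nonneg fun j _ => sub_nonneg.2 (hq j)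
  have amgm : ∀ z : Fin t → ℝ, (∀ j, 0 ≤ z j) →
      (∏ j, z j) ^ (1 / t : ℝ) ≤ ∑ j, (1 / t : ℝ) * z j := by
    intro z hz
    rw [← Real.finsetProd_rpow _ _ fun j _ => hz j]
    refine Real.geom_mean_le_arith_mean_weighted _ (fun _ => (1 / t : ℝ)) z
      (fun _ _ => by positivity) ?_ (fun j _ => hz j)
    simp [ht'.ne']
  -- Superadditivity of the geometric mean: `1/q_j` and `(q_j - 1)/q_j` add up to 1, so the sum of
  -- their geometric means is at most 1.
  have h1 := amgm (fun j => 1 / q j) fun j => by have := hq0 j; positivity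
  have h2 := amgm (fun j => (q j - 1) / q j) fun j =>
    div_nonneg (sub_nonneg.2 (hq j)) (hq0 j).le
  have h3 : ∑ j, (1 / t : ℝ) * (1 / q j) + ∑ j, (1 / t : ℝ) * ((q j - 1) / q j) = 1 := by
    rw [← Finset.sum_add_distrib]
    have : ∀ j, (1 / t : ℝ) * (1 / q j) + (1 / t : ℝ) * ((q j - 1) / q j) = 1 / t := by
      intro j
      have := (hq0 j).ne'
      field_simp
      ring
    rw [Finset.sum_congr rfl fun j _ => this j]
    simp [ht'.ne']
  rw [Finset.prod_div_distrib, Finset.prod_const_one,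
    Real.div_rpow zero_le_one hP.le, Real.one_rpow] at h1
  rw [Finset.prod_div_distrib, Real.div_rpow hE hP.le] at h2
  have hPw : 0 < (∏ j, q j) ^ (1 / t : ℝ) := Real.rpow_pos_of_pos hP _
  have h4 : 1 + (∏ j, (q j - 1)) ^ (1 / t : ℝ) ≤ (∏ j, q j) ^ (1 / t : ℝ) := by
    have := add_le_add h1 h2
    rw [h3, ← add_div, div_le_one hPw] at this
    exact this
  have h5 : (∏ j, q j) ^ (1 / t : ℝ) ≤ D ^ (1 / t : ℝ) :=
    Real.rpow_le_rpow hP.le hD (by positivity)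
  calc ∏ j, (q j - 1) = ((∏ j, (q j - 1)) ^ (1 / t : ℝ)) ^ t := by
        rw [← Real.rpow_natCast, ← Real.rpow_mul hE, one_div, inv_mul_cancel₀ ht'.ne',
          Real.rpow_one]
    _ ≤ _ := pow_le_pow_left₀ (Real.rpow_nonneg hE _) (by linarith) t

/-- By convexity `exp` lies below its chord on `[0, 2/3]`, and `exp (2/3) ≤ 2` because `e² ≤ 8`.
This is the source of the constant 3 in the final bound. -/
theorem exp_two_mul_sub_one_le {x : ℝ} (h0 : 0 ≤ x) (h1 : x ≤ 1 / 3) :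
    Real.exp (2 * x) - 1 ≤ 3 * x := by
  have he : Real.exp (2 / 3) ≤ 2 := by
    have h : Real.exp (2 / 3) ^ 3 ≤ 2 ^ 3 := by
      rw [← Real.exp_nat_mul]
      have h1 := Real.exp_one_lt_d9
      have h2 : Real.exp ((3 : ℕ) * (2 / 3)) = Real.exp 1 ^ 2 := by
        rw [← Real.exp_nat_mul]; norm_num
      rw [h2]
      nlinarith [Real.exp_pos 1]
    exact le_of_pow_le_pow_left₀ (by norm_num) (by norm_num) h
  have hc := convexOn_exp.2 (Set.mem_univ 0) (Set.mem_univ (2 / 3 : ℝ))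
    (by linarith : (0 : ℝ) ≤ 1 - 3 * x) (by linarith : (0 : ℝ) ≤ 3 * x) (by ring)
  simp only [smul_eq_mul, mul_zero, zero_add, Real.exp_zero, mul_one] at hc
  have h2 : 3 * x * (2 / 3) = 2 * x := by ring
  rw [h2] at hc
  nlinarith

/-- Kaporin's ratio `((a + b) / 2) ^ 2 / (a * b)` of two positive numbers. -/
noncomputable def pairRatio (a b : ℝ) : ℝ := (a + b) ^ 2 / (4 * a * b)

theorem one_le_pairRatio {a b : ℝ} (ha : 0 < a) (hb : 0 < b) : 1 ≤ pairRatio a b := by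
  rw [pairRatio, one_le_div (by positivity)]
  nlinarith [sq_nonneg (a - b)]

theorem pairRatio_mul {a b : ℝ} (ha : 0 < a) (hb : 0 < b) :
    pairRatio a b * (a * b) = ((a + b) / 2) ^ 2 := by
  rw [pairRatio]
  field_simp
  norm_num

theorem pairRatio_sub_one {a b : ℝ} (ha : 0 < a) (hb : 0 < b) :
    pairRatio a b - 1 = (b - a) ^ 2 / (4 * a * b) := by
  rw [pairRatio]
  field_simp
  ring

theorem linear_sq_le_pairRatio {a b x : ℝ} (ha : 0 < a) (hb : 0 < b) (hax : a ≤ x) (hxb : x ≤ b) :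
    (1 - 2 / (a + b) * x) ^ 2 ≤ pairRatio a b - 1 := by
  rw [pairRatio_sub_one ha hb]
  have h : 1 - 2 / (a + b) * x = (a + b - 2 * x) / (a + b) := by field_simp
  rw [h, div_pow]
  refine div_le_div₀ (sq_nonneg _) ?_ (by positivity) ?_
  · nlinarith
  · nlinarith [sq_nonneg (a - b)]

theorem quadratic_sq_le_pairRatio {a b x : ℝ} (ha : 0 < a) (hb : 0 < b) (hax : a ≤ x)
    (hxb : x ≤ b) :
    ((1 - a⁻¹ * x) * (1 - b⁻¹ * x)) ^ 2 ≤ (pairRatio a b - 1) * (pairRatio a b - 1) := by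
  rw [← sq, pairRatio_sub_one ha hb]
  have h : (1 - a⁻¹ * x) * (1 - b⁻¹ * x) = -(4 * ((x - a) * (b - x))) / (4 * a * b) := by
    field_simp
    ring
  rw [h, neg_div, neg_sq]
  have h0 : 0 ≤ (x - a) * (b - x) := mul_nonneg (by linarith) (by linarith)
  refine pow_le_pow_left₀ (by positivity) ?_ 2
  gcongr
  nlinarith [sq_nonneg (a + b - 2 * x)]

open Polynomial in
theorem natDegree_one_sub_C_mul_X_le (c : ℝ) : (1 - C c * X : ℝ[X]).natDegree ≤ 1 :=
  (natDegree_sub_le _ _).trans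
    (max_le (by simp) ((natDegree_C_mul_le _ _).trans natDegree_X_le))

open Polynomial in
-- The induction goes down by two in `t`, removing the two extreme points each time. The list `q`
-- records the ratios used and `m` is `l` with the used pairs averaged. The product relation is an
-- inequality only because of the linear factor for odd `t`.
theorem exists_polynomial_sq_le_prod {ι : Type*} [DecidableEq ι] (l : ι → ℝ) :
    ∀ (t : ℕ) (s : Finset ι), (∀ i ∈ s, 0 < l i) →
      ∃ (p : ℝ[X]) (q : Fin t → ℝ) (m : ι → ℝ), p.natDegree ≤ t ∧ p.eval 0 = 1 ∧
        (∀ j, 1 ≤ q j) ∧ (∀ i ∈ s, 0 < m i) ∧ ∑ i ∈ s, m i = ∑ i ∈ s, l i ∧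
        (∏ j, q j) * (∏ i ∈ s, l i) ^ 2 ≤ (∏ i ∈ s, m i) ^ 2 ∧
        ∀ i ∈ s, (p.eval (l i)) ^ 2 ≤ ∏ j, (q j - 1) := by
  have hsplit : ∀ (t : ℕ) (s : Finset ι), (∀ i ∈ s, 0 < l i) →
      (∃ (p : ℝ[X]) (q : Fin (t + 1) → ℝ) (m : ι → ℝ), p.natDegree ≤ t + 1 ∧ p.eval 0 = 1 ∧
        (∀ j, 1 ≤ q j) ∧ (∀ i ∈ s, 0 < m i) ∧ ∑ i ∈ s, m i = ∑ i ∈ s, l i ∧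
        (∏ j, q j) * (∏ i ∈ s, l i) ^ 2 ≤ (∏ i ∈ s, m i) ^ 2 ∧
        ∀ i ∈ s, (p.eval (l i)) ^ 2 ≤ ∏ j, (q j - 1)) ∨
      ∃ (a b : ι) (s' : Finset ι), a ≠ b ∧ 0 < l a ∧ 0 < l b ∧ a ∉ s' ∧ b ∉ s' ∧
        s = insert a (insert b s') ∧ ∀ i ∈ s, l a ≤ l i ∧ l i ≤ l b := by
    intro t s hs
    rcases s.eq_empty_or_nonempty with rfl | hne
    · left
      exact ⟨1, fun _ => 1, l, by simp, by simp, by simp, by simp, by simp, by simp, by simp⟩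
    obtain ⟨a, ha, hamin⟩ := s.exists_min_image l hne
    obtain ⟨b, hb, hbmax⟩ := s.exists_max_image l hne
    by_cases hab : l a = l b
    · left
      have h0 : l a ≠ 0 := (hs a ha).ne'
      -- With a single distinct value left, one linear factor vanishes everywhere on `s`; taking all
      -- `q j = 1` makes the claimed bound 0, since `Fin (t + 1)` is nonempty.
      refine ⟨1 - C (l a)⁻¹ * X, fun _ => 1, l, ?_, by simp, by simp, hs, rfl, by simp, ?_⟩
      · exact (natDegree_one_sub_C_mul_X_le _).trans (by omega)
      · intro i hi
        have : l i = l a := le_antisymm (hab ▸ hbmax i hi) (hamin i hi)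
        simp [this, h0]
    · right
      have hne : a ≠ b := fun h => hab (h ▸ rfl)
      refine ⟨a, b, (s.erase a).erase b, hne, hs a ha, hs b hb, by simp, by simp, ?_,
        fun i hi => ⟨hamin i hi, hbmax i hi⟩⟩
      rw [Finset.insert_erase (Finset.mem_erase.2 ⟨hne.symm, hb⟩), Finset.insert_erase ha]
  -- averaging the entries at `a` and `b`
  have havg : ∀ (a b : ι) (s' : Finset ι) (m : ι → ℝ), a ≠ b → 0 < l a → 0 < l b →
      a ∉ s' → b ∉ s' → (∀ i ∈ s', 0 < m i) → ∑ i ∈ s', m i = ∑ i ∈ s', l i →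
      ∃ m' : ι → ℝ, (∀ i ∈ insert a (insert b s'), 0 < m' i) ∧
        ∑ i ∈ insert a (insert b s'), m' i = ∑ i ∈ insert a (insert b s'), l i ∧
        ∏ i ∈ insert a (insert b s'), m' i = ((l a + l b) / 2) ^ 2 * ∏ i ∈ s', m i := by
    intro a b s' m hab ha hb has hbs hm hsum
    have hab' : a ∉ insert b s' := by simp [hab, has]
    have hcongr : ∀ i ∈ s', (if i = a ∨ i = b then (l a + l b) / 2 else m i) = m i := by
      intro i hi
      rw [if_neg]
      rintro (rfl | rfl) <;> contradiction
    refine ⟨fun i => if i = a ∨ i = b then (l a + l b) / 2 else m i, ?_, ?_, ?_⟩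
    · intro i hi
      by_cases h : i = a ∨ i = b
      · simp only [if_pos h]; positivity
      · simp only [if_neg h]
        push Not at h
        exact hm i (by simpa [h.1, h.2] using hi)
    · rw [Finset.sum_insert hab', Finset.sum_insert hbs, Finset.sum_insert hab',
        Finset.sum_insert hbs, Finset.sum_congr rfl hcongr, hsum]
      simp only [true_or, or_true, if_true]
      ring
    · rw [Finset.prod_insert hab', Finset.prod_insert hbs, Finset.prod_congr rfl hcongr]
      simp only [true_or, or_true, if_true]
      ring
  intro t
  induction t using Nat.twoStepInduction with
  | zero =>
    intro s hs
    exact ⟨1, fun _ => 1, l, by simp, by simp, by simp, hs, rfl, by simp, by simp⟩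
  | one =>
    intro s hs
    rcases hsplit 0 s hs with h | ⟨a, b, s', hab, ha, hb, has, hbs, rfl, hbd⟩
    · exact h
    have hab' : a ∉ insert b s' := by simp [hab, has]
    have hs' : ∀ i ∈ s', 0 < l i := fun i hi => hs i (by simp [hi])
    obtain ⟨m, hm, hsum, hprod⟩ := havg a b s' l hab ha hb has hbs hs' rfl
    refine ⟨1 - C (2 / (l a + l b)) * X, fun _ => pairRatio (l a) (l b), m, ?_, by simp,
      fun _ => one_le_pairRatio ha hb, hm, hsum, ?_, ?_⟩
    · exact natDegree_one_sub_C_mul_X_le _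
    · rw [hprod, Finset.prod_insert hab', Finset.prod_insert hbs, Fin.prod_univ_one,
        ← pairRatio_mul ha hb]
      have h1 := one_le_pairRatio ha hb
      have h2 : 0 ≤ (l a * l b * ∏ i ∈ s', l i) ^ 2 := sq_nonneg _
      -- Averaging the pair gains `q²` in the squared product while the list contains `q` only once;
      -- the slack is a factor `q ≥ 1`.
      nlinarith [mul_nonneg (mul_nonneg (sub_nonneg.2 h1) (zero_le_one.trans h1)) h2]
    · intro i hi
      simpa using linear_sq_le_pairRatio ha hb (hbd i hi).1 (hbd i hi).2
  | more t ih _ =>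
    intro s hs
    rcases hsplit (t + 1) s hs with h | ⟨a, b, s', hab, ha, hb, has, hbs, rfl, hbd⟩
    · exact h
    have hab' : a ∉ insert b s' := by simp [hab, has]
    have hs' : ∀ i ∈ s', 0 < l i := fun i hi => hs i (by simp [hi])
    obtain ⟨p, q, m₀, hdeg, hp0, hq, hm₀, hsum₀, hprod₀, hle⟩ := ih s' hs'
    obtain ⟨m, hm, hsum, hprod⟩ := havg a b s' m₀ hab ha hb has hbs hm₀ hsum₀
    have h1 := one_le_pairRatio ha hb
    refine ⟨(1 - C (l a)⁻¹ * X) * (1 - C (l b)⁻¹ * X) * p,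
      Fin.cons (pairRatio (l a) (l b)) (Fin.cons (pairRatio (l a) (l b)) q), m, ?_, by simp [hp0],
      ?_, hm, hsum, ?_, ?_⟩
    · have h1 := natDegree_one_sub_C_mul_X_le (l a)⁻¹
      have h2 := natDegree_one_sub_C_mul_X_le (l b)⁻¹
      have h3 := natDegree_mul_le (p := (1 - C (l a)⁻¹ * X)) (q := (1 - C (l b)⁻¹ * X))
      have h4 := natDegree_mul_le (p := (1 - C (l a)⁻¹ * X) * (1 - C (l b)⁻¹ * X)) (q := p)
      omega
    · intro j
      refine Fin.cases ?_ (fun j => ?_) j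
      · simpa using h1
      · refine Fin.cases ?_ (fun j => ?_) j
        · simpa using h1
        · simpa using hq j
    · rw [hprod, Finset.prod_insert hab', Finset.prod_insert hbs, Fin.prod_univ_succ,
        Fin.prod_univ_succ]
      simp only [Fin.cons_zero, Fin.cons_succ]
      rw [← pairRatio_mul ha hb]
      have h2 : 0 ≤ (pairRatio (l a) (l b) * (l a * l b)) ^ 2 := sq_nonneg _
      nlinarith [mul_le_mul_of_nonneg_left hprod₀ h2]
    · intro i hi
      rw [Fin.prod_univ_succ, Fin.prod_univ_succ]
      simp only [Fin.cons_zero, Fin.cons_succ]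
      have hquad := quadratic_sq_le_pairRatio ha hb (hbd i hi).1 (hbd i hi).2
      have hE : 0 ≤ ∏ j, (q j - 1) := Finset.prod_nonneg fun j _ => sub_nonneg.2 (hq j)
      by_cases his : i ∈ s'
      · rw [← mul_assoc, eval_mul, mul_pow]
        refine mul_le_mul ?_ (hle i his) (sq_nonneg _) (mul_self_nonneg _)
        simpa using hquad
      -- The induction hypothesis says nothing about `p` at the removed points, but the quadratic
      -- factor vanishes there.
      · have : i = a ∨ i = b := by simpa [his] using hi
        have h0 : eval (l i) ((1 - C (l a)⁻¹ * X) * (1 - C (l b)⁻¹ * X) * p) = 0 := by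
          rcases this with rfl | rfl <;> simp [ha.ne', hb.ne']
        rw [h0, ← mul_assoc]
        have := mul_nonneg (mul_self_nonneg (pairRatio (l a) (l b) - 1)) hE
        simpa using this

theorem prod_le_mean_pow {ι : Type*} {s : Finset ι} {l : ι → ℝ} (hl : ∀ i ∈ s, 0 ≤ l i) :
    ∏ i ∈ s, l i ≤ (1 / (s.card : ℝ) * ∑ i ∈ s, l i) ^ s.card := by
  rcases s.eq_empty_or_nonempty with rfl | hne
  · simp
  have hc : (0 : ℝ) < s.card := by exact_mod_cast hne.card_pos
  have h := Real.geom_mean_le_arith_mean_weighted s (fun _ => (1 / s.card : ℝ)) l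
    (fun _ _ => by positivity) (by simp [hc.ne']) hl
  rw [Real.finsetProd_rpow _ _ hl, ← Finset.mul_sum] at h
  have hP := Finset.prod_nonneg hl
  calc ∏ i ∈ s, l i = ((∏ i ∈ s, l i) ^ (1 / s.card : ℝ)) ^ s.card := by
        rw [← Real.rpow_natCast, ← Real.rpow_mul hP, one_div, inv_mul_cancel₀ hc.ne',
          Real.rpow_one]
    _ ≤ _ := pow_le_pow_left₀ (Real.rpow_nonneg hP _) h _

theorem one_le_mean_pow_div_prod {ι : Type*} {s : Finset ι} {l : ι → ℝ} (hl : ∀ i ∈ s, 0 < l i) :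
    1 ≤ (1 / (s.card : ℝ) * ∑ i ∈ s, l i) ^ s.card / ∏ i ∈ s, l i := by
  rw [one_le_div (Finset.prod_pos hl)]
  exact prod_le_mean_pow fun i hi => (hl i hi).le

open Polynomial in
/-- A polynomial normalized at `0` that is small on a finite set of positive numbers, in terms of
the quotient of their arithmetic and geometric means. -/
theorem exists_polynomial_sq_le_log {ι : Type*} {s : Finset ι} {l : ι → ℝ}
    (hl : ∀ i ∈ s, 0 < l i) {t : ℕ} (ht : 0 < t) :
    ∃ p : ℝ[X], p.natDegree ≤ t ∧ p.eval 0 = 1 ∧ ∀ i ∈ s, (p.eval (l i)) ^ 2 ≤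
      (3 * Real.log ((1 / (s.card : ℝ) * ∑ i ∈ s, l i) ^ s.card / ∏ i ∈ s, l i) / t) ^ t := by
  classical
  set k : ℝ := (1 / (s.card : ℝ) * ∑ i ∈ s, l i) ^ s.card / ∏ i ∈ s, l i with hk
  have hk1 : 1 ≤ k := one_le_mean_pow_div_prod hl
  have hk0 : 0 < k := one_pos.trans_le hk1
  have ht' : (0 : ℝ) < t := by exact_mod_cast ht
  have hlog : 0 ≤ Real.log k := Real.log_nonneg hk1
  rcases le_total 1 (3 * Real.log k / t) with h | h
  · exact ⟨1, by simp, by simp, fun i _ => by simpa using one_le_pow₀ h⟩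
  obtain ⟨p, q, m, hdeg, hp0, hq, hm, hsum, hprod, hle⟩ := exists_polynomial_sq_le_prod l t s hl
  refine ⟨p, hdeg, hp0, fun i hi => (hle i hi).trans ?_⟩
  have hpl : 0 < ∏ i ∈ s, l i := Finset.prod_pos hl
  have hD : ∏ j, q j ≤ k ^ 2 := by
    rw [hk, div_pow, le_div_iff₀ (by positivity)]
    refine hprod.trans (pow_le_pow_left₀ (Finset.prod_pos hm).le ?_ 2)
    rw [← hsum]
    exact prod_le_mean_pow fun i hi => (hm i hi).le
  refine (prod_sub_one_le_pow ht hq hD).trans (pow_le_pow_left₀ ?_ ?_ t)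
  · rw [sub_nonneg]
    exact Real.one_le_rpow (one_le_pow₀ hk1) (by positivity)
  · have hx : (k ^ 2) ^ (1 / t : ℝ) = Real.exp (2 * (Real.log k / t)) := by
      rw [Real.rpow_def_of_pos (by positivity), Real.log_pow]
      congr 1
      push_cast
      ring
    rw [hx, mul_div_assoc]
    rw [mul_div_assoc] at h
    exact exp_two_mul_sub_one_le (by positivity) (by linarith)

/-! ### Krylov spaces and the PCG iterates -/

variable {n : ℕ}

theorem star_dotProduct_mulVec {M : Matrix (Fin n) (Fin n) ℂ} (hM : M.IsHermitian)
    (v w : Fin n → ℂ) : star v ⬝ᵥ (M *ᵥ w) = star (M *ᵥ v) ⬝ᵥ w := by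
  rw [star_mulVec, hM.eq, dotProduct_mulVec]

theorem star_star_dotProduct_mulVec_self {M : Matrix (Fin n) (Fin n) ℂ} (hM : M.IsHermitian)
    (v : Fin n → ℂ) : star (star v ⬝ᵥ (M *ᵥ v)) = star v ⬝ᵥ (M *ᵥ v) := by
  conv_rhs => rw [star_dotProduct_mulVec hM]
  rw [star_dotProduct, star_star, dotProduct_comm]

/-- The Krylov space spanned by `z, C z, …, C ^ (t - 1) z`. -/
def krylov (C : Matrix (Fin n) (Fin n) ℂ) (z : Fin n → ℂ) : ℕ → Submodule ℂ (Fin n → ℂ)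
  | 0 => ⊥
  | t + 1 => Submodule.span ℂ {z} ⊔ (krylov C z t).map C.mulVecLin

section krylov

variable {C : Matrix (Fin n) (Fin n) ℂ} {z : Fin n → ℂ}

theorem mem_krylov_succ_self (t : ℕ) : z ∈ krylov C z (t + 1) :=
  Submodule.mem_sup_left (Submodule.mem_span_singleton_self z)

theorem mulVec_mem_krylov {t : ℕ} {v : Fin n → ℂ} (hv : v ∈ krylov C z t) :
    C *ᵥ v ∈ krylov C z (t + 1) :=
  Submodule.mem_sup_right ⟨v, hv, rfl⟩

theorem krylov_mono : Monotone (krylov C z) := by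
  refine monotone_nat_of_le_succ fun t => ?_
  induction t with
  | zero => exact bot_le
  | succ t ih => exact sup_le_sup_left (Submodule.map_mono ih) _

theorem krylov_succ_le {t : ℕ} {N : Submodule ℂ (Fin n → ℂ)} (hz : z ∈ N)
    (h : ∀ v ∈ krylov C z t, C *ᵥ v ∈ N) : krylov C z (t + 1) ≤ N := by
  refine sup_le ((Submodule.span_singleton_le_iff_mem _ _).2 hz) ?_
  rintro _ ⟨v, hv, rfl⟩
  exact h v hv

theorem pow_mulVec_mem_krylov (i : ℕ) : (C ^ i) *ᵥ z ∈ krylov C z (i + 1) := by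
  induction i with
  | zero => simpa using mem_krylov_succ_self 0
  | succ i ih =>
    rw [pow_succ', ← mulVec_mulVec]
    exact mulVec_mem_krylov ih

open Polynomial in
theorem aeval_mulVec_mem_krylov {p : ℝ[X]} {t : ℕ} (hp : p.natDegree < t) :
    aeval C p *ᵥ z ∈ krylov C z t := by
  rw [aeval_eq_sum_range, Matrix.sum_mulVec]
  refine Submodule.sum_mem _ fun i hi => ?_
  rw [smul_mulVec]
  refine Submodule.smul_of_tower_mem _ _ (krylov_mono ?_ (pow_mulVec_mem_krylov i))
  have := Finset.mem_range.1 hi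
  omega

end krylov

/-- The relations between the PCG state after `t` iterations and the Krylov spaces. -/
structure KrylovInvariant (A M : Matrix (Fin n) (Fin n) ℂ) (x₀ z₀ : Fin n → ℂ) (t : ℕ)
    (s : PCGState n) : Prop where
  x_mem : s.x - x₀ ∈ krylov (M * A) z₀ t
  z_mem : M *ᵥ s.r ∈ krylov (M * A) z₀ (t + 1)
  d_mem : s.d ∈ krylov (M * A) z₀ (t + 1)
  orthogonal : ∀ v ∈ krylov (M * A) z₀ t, star v ⬝ᵥ s.r = 0
  conjugate : ∀ v ∈ krylov (M * A) z₀ t, star v ⬝ᵥ (A *ᵥ s.d) = 0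
  krylov_le : krylov (M * A) z₀ (t + 1) ≤ krylov (M * A) z₀ t ⊔ Submodule.span ℂ {s.d}
  d_dot_r : star s.d ⬝ᵥ s.r = star s.r ⬝ᵥ (M *ᵥ s.r)
  d_eq_zero : star s.r ⬝ᵥ (M *ᵥ s.r) = 0 → s.d = 0
  d_mem_range : s.d ∈ LinearMap.range M.mulVecLin

/-- The field `krylov_le` lets every statement about `K (t + 1)` be checked on `K t` and on `d`
alone. The hypothesis `hinj` makes `d* A d` nonzero whenever `d ≠ 0`, so the step can degenerate
only when `d = 0`. -/
theorem KrylovInvariant.pcgStep {A Ahat : Matrix (Fin n) (Fin n) ℂ} (hA : A.PosSemidef)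
    (hM : (pinv Ahat).PosSemidef)
    (hinj : ∀ v ∈ LinearMap.range (pinv Ahat).mulVecLin, A *ᵥ v = 0 → v = 0)
    {x₀ z₀ : Fin n → ℂ} {t : ℕ} {s : PCGState n}
    (h : KrylovInvariant A (pinv Ahat) x₀ z₀ t s) :
    KrylovInvariant A (pinv Ahat) x₀ z₀ (t + 1) (pcgStep A Ahat s) := by
  obtain ⟨x, r, d⟩ := s
  set M := pinv Ahat with hMdef
  set K := krylov (M * A) z₀ with hK
  set ρ : ℂ := star r ⬝ᵥ (M *ᵥ r) with hρ
  set δ : ℂ := star d ⬝ᵥ (A *ᵥ d) with hδ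
  set α : ℂ := ρ / δ with hα
  set r' : Fin n → ℂ := r - α • (A *ᵥ d) with hr'
  set ρ' : ℂ := star r' ⬝ᵥ (M *ᵥ r') with hρ'
  set d' : Fin n → ℂ := M *ᵥ r' + (ρ' / ρ) • d with hd'
  have hstep : KaporinPCG.pcgStep A Ahat ⟨x, r, d⟩ = ⟨x + α • d, r', d'⟩ := rfl
  rw [hstep]
  obtain ⟨hx, hz, hd, ho, hc, hle, hdr, hd0, hdR⟩ := h
  dsimp only at hx hz hd ho hc hle hdr hd0 hdR
  have hmono : K t ≤ K (t + 1) := krylov_mono t.le_succ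
  have hmono' : K (t + 1) ≤ K (t + 2) := krylov_mono (t + 1).le_succ
  have hzr : ∀ v : Fin n → ℂ, star v ⬝ᵥ (M *ᵥ v) = 0 → M *ᵥ v = 0 := fun v hv =>
    (hM.dotProduct_mulVec_zero_iff v).1 hv
  have hx' : x + α • d - x₀ ∈ K (t + 1) := by
    have : x + α • d - x₀ = (x - x₀) + α • d := by abel
    rw [this]
    exact add_mem (hmono hx) (Submodule.smul_mem _ _ hd)
  have hz' : M *ᵥ r' ∈ K (t + 2) := by
    rw [hr', mulVec_sub, mulVec_smul, mulVec_mulVec]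
    exact sub_mem (hmono' hz) (Submodule.smul_mem _ _ (mulVec_mem_krylov hd))
  have hd'mem : d' ∈ K (t + 2) := add_mem hz' (Submodule.smul_mem _ _ (hmono' hd))
  have hd'R : d' ∈ LinearMap.range M.mulVecLin :=
    add_mem ⟨r', rfl⟩ (Submodule.smul_mem _ _ hdR)
  have hd'0 : ρ' = 0 → d' = 0 := by
    intro h0
    rw [hd', hzr r' h0, h0, zero_div, zero_smul, add_zero]
  -- Exact convergence: all quotients are 0, the residual no longer changes, and the Krylov spaces
  -- have stopped growing.
  by_cases hd00 : d = 0
  · have hρ0 : ρ = 0 := by rw [hρ, ← hdr, hd00, star_zero, zero_dotProduct]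
    have hr'r : r' = r := by rw [hr', hα, hρ0, zero_div, zero_smul, sub_zero]
    have hρ'0 : ρ' = 0 := by rw [hρ', hr'r, ← hρ, hρ0]
    have hd'0' : d' = 0 := hd'0 hρ'0
    have hKle : K (t + 1) ≤ K t := by
      refine hle.trans ?_
      rw [hd00, Submodule.span_zero_singleton, sup_bot_eq]
    refine ⟨hx', hz', hd'mem, fun v hv => ?_, fun v hv => ?_, ?_, ?_, hd'0, hd'R⟩
    · dsimp only
      rw [hr'r]
      exact ho v (hKle hv)
    · dsimp only
      rw [hd'0', mulVec_zero, dotProduct_zero]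
    · refine le_trans ?_ le_sup_left
      exact krylov_succ_le (mem_krylov_succ_self t) fun v hv => mulVec_mem_krylov (hKle hv)
    · dsimp only
      rw [hd'0', star_zero, zero_dotProduct, ← hρ', hρ'0]
  have hρ0 : ρ ≠ 0 := fun h0 => hd00 (hd0 h0)
  have hδ0 : δ ≠ 0 := fun h0 => hd00 (hinj d hdR ((hA.dotProduct_mulVec_zero_iff d).1 h0))
  have hα0 : α ≠ 0 := div_ne_zero hρ0 hδ0
  have hαδ : α * δ = ρ := div_mul_cancel₀ ρ hδ0
  have hαstar : star α = α := by
    rw [hα, star_div₀, hρ, hδ, star_star_dotProduct_mulVec_self hM.isHermitian,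
      star_star_dotProduct_mulVec_self hA.isHermitian]
  have hdr' : star d ⬝ᵥ r' = 0 := by
    rw [hr', dotProduct_sub, dotProduct_smul, hdr, ← hδ, smul_eq_mul, hαδ, sub_self]
  have hmem : ∀ v ∈ K (t + 1), ∃ k ∈ K t, ∃ c : ℂ, v = k + c • d := by
    intro v hv
    obtain ⟨k, hk, w, hw, rfl⟩ := Submodule.mem_sup.1 (hle hv)
    obtain ⟨c, rfl⟩ := Submodule.mem_span_singleton.1 hw
    exact ⟨k, hk, c, rfl⟩
  have ho' : ∀ v ∈ K (t + 1), star v ⬝ᵥ r' = 0 := by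
    intro v hv
    obtain ⟨k, hk, c, rfl⟩ := hmem v hv
    have h1 : star k ⬝ᵥ r' = 0 := by
      rw [hr', dotProduct_sub, dotProduct_smul, ho k hk, hc k hk, smul_zero, sub_zero]
    rw [star_add, star_smul, add_dotProduct, smul_dotProduct, h1, hdr', smul_zero, add_zero]
  have hAd : α • (A *ᵥ d) = r - r' := by rw [hr', sub_sub_cancel]
  have hdd : star d ⬝ᵥ (A *ᵥ d') = 0 := by
    -- Since `α A d = r - r'`, the `A`-product with `d` becomes a difference of residual products,
    -- one of which vanishes because `M r` lies in `K (t + 1)`.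
    have h1 : α * (star d ⬝ᵥ (A *ᵥ (M *ᵥ r'))) = -ρ' := by
      calc α * (star d ⬝ᵥ (A *ᵥ (M *ᵥ r'))) = star (α • (A *ᵥ d)) ⬝ᵥ (M *ᵥ r') := by
            rw [star_dotProduct_mulVec hA.isHermitian, star_smul, hαstar, smul_dotProduct,
              smul_eq_mul]
        _ = star (M *ᵥ r) ⬝ᵥ r' - ρ' := by
            rw [hAd, star_sub, sub_dotProduct, ← star_dotProduct_mulVec hM.isHermitian]
        _ = -ρ' := by rw [ho' _ hz, zero_sub]
    refine (mul_eq_zero.1 ?_).resolve_left hα0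
    rw [hd', mulVec_add, mulVec_smul, dotProduct_add, dotProduct_smul, ← hδ, smul_eq_mul,
      mul_add, h1]
    calc -ρ' + α * (ρ' / ρ * δ) = -ρ' + ρ' / ρ * (α * δ) := by ring
      _ = 0 := by rw [hαδ, div_mul_cancel₀ _ hρ0, neg_add_cancel]
  refine ⟨hx', hz', hd'mem, ho', fun v hv => ?_, ?_, ?_, hd'0, hd'R⟩
  · obtain ⟨k, hk, c, rfl⟩ := hmem v hv
    have h1 : star k ⬝ᵥ (A *ᵥ d') = 0 := by
      rw [hd', mulVec_add, mulVec_smul, dotProduct_add, dotProduct_smul, hc k hk, smul_zero,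
        add_zero, star_dotProduct_mulVec hA.isHermitian, star_dotProduct_mulVec hM.isHermitian,
        mulVec_mulVec]
      exact ho' _ (mulVec_mem_krylov hk)
    dsimp only
    rw [star_add, star_smul, add_dotProduct, smul_dotProduct, h1, hdd, smul_zero, add_zero]
  · dsimp only
    set N := K (t + 1) ⊔ Submodule.span ℂ {d'} with hN
    have hKN : K (t + 1) ≤ N := le_sup_left
    have hd'N : d' ∈ N := Submodule.mem_sup_right (Submodule.mem_span_singleton_self _)
    refine krylov_succ_le (hKN (mem_krylov_succ_self t)) fun v hv => ?_
    obtain ⟨k, hk, c, rfl⟩ := hmem v hv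
    rw [mulVec_add, mulVec_smul]
    refine add_mem (hKN (mulVec_mem_krylov hk)) (Submodule.smul_mem _ _ ?_)
    -- The residual update expresses `α M A d` as `M r - M r'`, and the direction update expresses
    -- `M r'` through `d'` and `d`.
    have h1 : (M * A) *ᵥ d = α⁻¹ • (M *ᵥ r - (d' - (ρ' / ρ) • d)) := by
      rw [hd', add_sub_cancel_right, ← mulVec_sub, ← hAd, mulVec_smul, smul_smul,
        inv_mul_cancel₀ hα0, one_smul, mulVec_mulVec]
    rw [h1]
    exact Submodule.smul_mem _ _ (sub_mem (hKN hz)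
      (sub_mem hd'N (Submodule.smul_mem _ _ (hKN hd))))
  · dsimp only
    rw [hd', star_add, star_smul, add_dotProduct, smul_dotProduct, hdr', smul_zero, add_zero,
      ← star_dotProduct_mulVec hM.isHermitian]

theorem krylovInvariant_pcg {A Ahat : Matrix (Fin n) (Fin n) ℂ} (hA : A.PosSemidef)
    (hM : (pinv Ahat).PosSemidef)
    (hinj : ∀ v ∈ LinearMap.range (pinv Ahat).mulVecLin, A *ᵥ v = 0 → v = 0)
    (b x₀ : Fin n → ℂ) (t : ℕ) :
    KrylovInvariant A (pinv Ahat) x₀ (pinv Ahat *ᵥ (b - A *ᵥ x₀)) t (pcg A Ahat b x₀ t) := by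
  induction t with
  | succ t ih => exact ih.pcgStep hA hM hinj
  | zero =>
    refine ⟨?_, mem_krylov_succ_self 0, mem_krylov_succ_self 0, ?_, ?_, ?_, ?_, ?_, ⟨_, rfl⟩⟩
    · simp [pcg]
    · intro v hv
      rw [(Submodule.mem_bot ℂ).1 hv, star_zero, zero_dotProduct]
    · intro v hv
      rw [(Submodule.mem_bot ℂ).1 hv, star_zero, zero_dotProduct]
    · exact krylov_succ_le (Submodule.mem_sup_right (Submodule.mem_span_singleton_self _))
        fun v hv => by
          rw [(Submodule.mem_bot ℂ).1 hv, mulVec_zero]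
          exact zero_mem _
    · exact (star_dotProduct_mulVec hM.isHermitian _ _).symm
    · exact (hM.dotProduct_mulVec_zero_iff _).1

theorem pcg_r_eq (A Ahat : Matrix (Fin n) (Fin n) ℂ) (b x₀ : Fin n → ℂ) (t : ℕ) :
    (pcg A Ahat b x₀ t).r = b - A *ᵥ (pcg A Ahat b x₀ t).x := by
  induction t with
  | zero => rfl
  | succ t ih => simp only [pcg, pcgStep, ih, mulVec_add, mulVec_smul]; abel

/-! ### The pseudoinverse of a positive-semidefinite matrix -/

/-- The conjugate transpose of `A⁺` also satisfies the Penrose equations for `A`, so uniqueness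
applies. -/
theorem pinv_isHermitian {A : Matrix (Fin n) (Fin n) ℂ} (hA : A.IsHermitian) :
    (pinv A).IsHermitian := by
  obtain ⟨h1, h2, h3, h4⟩ := isMoorePenroseInverse_pinv A
  refine IsMoorePenroseInverse.unique (A := A) ⟨?_, ?_, ?_, ?_⟩ ⟨h1, h2, h3, h4⟩
  · have := congrArg conjTranspose h1
    simpa only [conjTranspose_mul, hA.eq, Matrix.mul_assoc] using this
  · have := congrArg conjTranspose h2
    simpa only [conjTranspose_mul, hA.eq, Matrix.mul_assoc] using this
  · have h : A * (pinv A)ᴴ = pinv A * A := by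
      rw [← h4.eq, conjTranspose_mul, hA.eq]
    rw [h]
    exact h4
  · have h : (pinv A)ᴴ * A = A * pinv A := by
      rw [← h3.eq, conjTranspose_mul, hA.eq]
    rw [h]
    exact h3

theorem mul_pinv_comm {A : Matrix (Fin n) (Fin n) ℂ} (hA : A.IsHermitian) :
    A * pinv A = pinv A * A := by
  have := (isMoorePenroseInverse_pinv A).isHermitian_left.eq
  rw [conjTranspose_mul, hA.eq, (pinv_isHermitian hA).eq] at this
  exact this.symm

theorem pinv_posSemidef {A : Matrix (Fin n) (Fin n) ℂ} (hA : A.PosSemidef) :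
    (pinv A).PosSemidef := by
  have h := hA.mul_mul_conjTranspose_same (pinv A)
  rwa [(pinv_isHermitian hA.isHermitian).eq, (isMoorePenroseInverse_pinv A).mul_mul_inv] at h

theorem pinv_mulVec_eq_zero_iff {A : Matrix (Fin n) (Fin n) ℂ} (hA : A.IsHermitian)
    (v : Fin n → ℂ) : pinv A *ᵥ v = 0 ↔ A *ᵥ v = 0 := by
  have h := isMoorePenroseInverse_pinv A
  constructor <;> intro hv
  · rw [← h.mul_mul_self, Matrix.mul_assoc, ← mul_pinv_comm hA, ← Matrix.mul_assoc,
      ← mulVec_mulVec, hv, mulVec_zero]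
  · rw [← h.mul_mul_inv, Matrix.mul_assoc, mul_pinv_comm hA, ← Matrix.mul_assoc,
      ← mulVec_mulVec, hv, mulVec_zero]

/-- The kernel of a Hermitian matrix is the orthogonal complement of its range. -/
theorem mulVec_eq_zero_of_range_le {A B : Matrix (Fin n) (Fin n) ℂ} (hA : A.IsHermitian)
    (hB : B.IsHermitian) (h : LinearMap.range A.mulVecLin ≤ LinearMap.range B.mulVecLin)
    {v : Fin n → ℂ} (hv : B *ᵥ v = 0) : A *ᵥ v = 0 := by
  obtain ⟨w, hw⟩ := h ⟨A *ᵥ v, rfl⟩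
  simp only [mulVecLin_apply] at hw
  rw [← dotProduct_star_self_eq_zero, star_dotProduct_mulVec hA, ← hw,
    ← star_dotProduct_mulVec hB, hv, dotProduct_zero]

/-! ### Least squares -/

theorem norm_toLp_add_sq {v w : Fin n → ℂ} (h : star v ⬝ᵥ w = 0) :
    ‖WithLp.toLp 2 (v + w)‖ ^ 2 = ‖WithLp.toLp 2 v‖ ^ 2 + ‖WithLp.toLp 2 w‖ ^ 2 := by
  have h0 : inner ℂ (WithLp.toLp 2 v) (WithLp.toLp 2 w) = 0 := by
    rw [EuclideanSpace.inner_toLp_toLp, dotProduct_comm, h]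
  have := norm_add_sq_eq_norm_sq_add_norm_sq_of_inner_eq_zero _ _ h0
  simpa only [sq, WithLp.toLp_add] using this

theorem mulVec_pinv_residual {A : Matrix (Fin n) (Fin n) ℂ} (hA : A.IsHermitian)
    (b : Fin n → ℂ) : A *ᵥ (A *ᵥ (pinv A *ᵥ b) - b) = 0 := by
  rw [mulVec_sub, mulVec_mulVec, mulVec_mulVec, Matrix.mul_assoc, mul_pinv_comm hA,
    ← Matrix.mul_assoc, (isMoorePenroseInverse_pinv A).mul_mul_self, sub_self]

/-- Pythagoras twice: the residual of `A⁺ b` lies in `ker A`, orthogonal to the range of `A`; and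
any other minimizer differs from `A⁺ b` by an element of `ker A`, while `A⁺ b` lies in the range. -/
theorem isMinNormLeastSquaresSolution_pinv {A : Matrix (Fin n) (Fin n) ℂ} (hA : A.IsHermitian)
    (b : Fin n → ℂ) : IsMinNormLeastSquaresSolution A b (pinv A *ᵥ b) := by
  set x := pinv A *ᵥ b with hx
  have hsplit : ∀ y, ‖WithLp.toLp 2 (A *ᵥ y - b)‖ ^ 2 =
      ‖WithLp.toLp 2 (A *ᵥ (y - x))‖ ^ 2 + ‖WithLp.toLp 2 (A *ᵥ x - b)‖ ^ 2 := by
    intro y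
    have : A *ᵥ y - b = A *ᵥ (y - x) + (A *ᵥ x - b) := by rw [mulVec_sub]; abel
    rw [this, norm_toLp_add_sq]
    rw [← star_dotProduct_mulVec hA, mulVec_pinv_residual hA, dotProduct_zero]
  refine ⟨fun y => ?_, fun y hy hyx => ?_⟩
  · refine le_of_sq_le_sq ?_ (norm_nonneg _)
    rw [hsplit y]
    exact le_add_of_nonneg_left (sq_nonneg _)
  · have h1 : A *ᵥ (y - x) = 0 := by
      have h2 := pow_le_pow_left₀ (norm_nonneg _) (hy x) 2
      rw [hsplit y] at h2
      have h3 : ‖WithLp.toLp 2 (A *ᵥ (y - x))‖ ^ 2 = 0 :=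
        le_antisymm (by linarith) (sq_nonneg _)
      simpa using h3
    have h2 : x = A *ᵥ (pinv A *ᵥ (pinv A *ᵥ b)) := by
      rw [mulVec_mulVec, mulVec_mulVec, mul_pinv_comm hA,
        (isMoorePenroseInverse_pinv A).mul_mul_inv]
    have h3 : star (y - x) ⬝ᵥ x = 0 := by
      conv_lhs => rw [h2, star_dotProduct_mulVec hA]
      rw [← h2, h1, star_zero, zero_dotProduct]
    have h4 := norm_toLp_add_sq h3
    rw [sub_add_cancel] at h4
    have h5 : 0 < ‖WithLp.toLp 2 (y - x)‖ := by
      rw [norm_pos_iff]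
      intro h
      exact hyx (sub_eq_zero.1 ((WithLp.toLp_eq_zero 2).1 h))
    refine lt_of_pow_lt_pow_left₀ 2 (norm_nonneg _) ?_
    rw [h4]
    have := pow_pos h5 2
    linarith

/-! ### Polynomials in Hermitian matrices -/

section aeval

open Polynomial

theorem dotProduct_aeval_mulVec {B : Matrix (Fin n) (Fin n) ℂ} {u : Fin n → ℂ} {lam : ℝ}
    (h : ∀ v, u ⬝ᵥ (B *ᵥ v) = lam * (u ⬝ᵥ v)) (p : ℝ[X]) (v : Fin n → ℂ) :
    u ⬝ᵥ (aeval B p *ᵥ v) = (p.eval lam : ℝ) * (u ⬝ᵥ v) := by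
  have hpow : ∀ k : ℕ, u ⬝ᵥ ((B ^ k) *ᵥ v) = (lam : ℂ) ^ k * (u ⬝ᵥ v) := by
    intro k
    induction k with
    | zero => simp
    | succ k ih => rw [pow_succ', ← mulVec_mulVec, h, ih]; ring
  rw [aeval_eq_sum_range, eval_eq_sum_range, Matrix.sum_mulVec, dotProduct_sum]
  push_cast
  rw [Finset.sum_mul]
  refine Finset.sum_congr rfl fun k _ => ?_
  rw [smul_mulVec, dotProduct_smul, hpow, Complex.real_smul]
  ring

theorem mul_aeval_of_semiconj {R B C : Matrix (Fin n) (Fin n) ℂ} (h : R * C = B * R)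
    (p : ℝ[X]) : R * aeval C p = aeval B p * R := by
  rw [aeval_eq_sum_range, aeval_eq_sum_range, Finset.mul_sum, Finset.sum_mul]
  refine Finset.sum_congr rfl fun k _ => ?_
  have hk : SemiconjBy R (C ^ k) (B ^ k) := SemiconjBy.pow_right h k
  rw [mul_smul_comm, smul_mul_assoc, hk.eq]

/-- Parseval in the eigenbasis. The second alternative is meant for zero eigenvalues, where `p`
equals 1 and only the absence of that component in `y` helps. -/
theorem norm_aeval_mulVec_sq_le {B : Matrix (Fin n) (Fin n) ℂ} (hB : B.IsHermitian) (p : ℝ[X])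
    {c : ℝ} (y : Fin n → ℂ) (h : ∀ i, (p.eval (hB.eigenvalues i)) ^ 2 ≤ c ∨
      star (hB.eigenvectorBasis i : Fin n → ℂ) ⬝ᵥ y = 0) :
    ‖WithLp.toLp 2 (aeval B p *ᵥ y)‖ ^ 2 ≤ c * ‖WithLp.toLp 2 y‖ ^ 2 := by
  rw [← hB.eigenvectorBasis.sum_sq_norm_inner_right (WithLp.toLp 2 (aeval B p *ᵥ y)),
    ← hB.eigenvectorBasis.sum_sq_norm_inner_right (WithLp.toLp 2 y), Finset.mul_sum]
  refine Finset.sum_le_sum fun i _ => ?_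
  have hu : ∀ v : Fin n → ℂ, star (hB.eigenvectorBasis i : Fin n → ℂ) ⬝ᵥ (B *ᵥ v) =
      hB.eigenvalues i * (star (hB.eigenvectorBasis i : Fin n → ℂ) ⬝ᵥ v) := by
    intro v
    rw [star_dotProduct_mulVec hB, hB.mulVec_eigenvectorBasis, star_smul, smul_dotProduct,
      star_trivial, Complex.real_smul]
  have hin : ∀ v : Fin n → ℂ, inner ℂ (hB.eigenvectorBasis i) (WithLp.toLp 2 v) =
      star (hB.eigenvectorBasis i : Fin n → ℂ) ⬝ᵥ v := fun v => by
    rw [EuclideanSpace.inner_eq_star_dotProduct, dotProduct_comm]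
  rw [hin, hin, dotProduct_aeval_mulVec hu, norm_mul, mul_pow, Complex.norm_real,
    Real.norm_eq_abs, sq_abs]
  rcases h i with h | h
  · exact mul_le_mul_of_nonneg_right h (sq_nonneg _)
  · rw [h]; simp

end aeval

/-! ### The symmetrized preconditioned matrix -/

theorem exists_conjTranspose_mul_self {A : Matrix (Fin n) (Fin n) ℂ} (hA : A.PosSemidef) :
    ∃ R : Matrix (Fin n) (Fin n) ℂ, A = Rᴴ * R := by
  open scoped MatrixOrder in
  exact CStarAlgebra.nonneg_iff_eq_star_mul_self.mp hA.nonneg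

theorem weightedNorm_sq (R : Matrix (Fin n) (Fin n) ℂ) (v : Fin n → ℂ) :
    weightedNorm (Rᴴ * R) v ^ 2 = ‖WithLp.toLp 2 (R *ᵥ v)‖ ^ 2 := by
  have h : (star v ⬝ᵥ ((Rᴴ * R) *ᵥ v)).re = ‖WithLp.toLp 2 (R *ᵥ v)‖ ^ 2 := by
    rw [← mulVec_mulVec, dotProduct_mulVec, ← star_mulVec, dotProduct_comm,
      ← EuclideanSpace.inner_toLp_toLp]
    exact inner_self_eq_norm_sq (𝕜 := ℂ) _
  rw [weightedNorm, h, Real.sq_sqrt (sq_nonneg _)]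

theorem weightedNorm_sq_add {A : Matrix (Fin n) (Fin n) ℂ} (hA : A.PosSemidef)
    {v w : Fin n → ℂ} (h : star w ⬝ᵥ (A *ᵥ v) = 0) :
    weightedNorm A v ^ 2 ≤ weightedNorm A (v + w) ^ 2 := by
  obtain ⟨R, rfl⟩ := exists_conjTranspose_mul_self hA
  have h0 : star (R *ᵥ w) ⬝ᵥ (R *ᵥ v) = 0 := by
    rw [star_mulVec, ← dotProduct_mulVec, mulVec_mulVec, h]
  rw [weightedNorm_sq, weightedNorm_sq, add_comm v w, mulVec_add, norm_toLp_add_sq h0]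
  exact le_add_of_nonneg_left (sq_nonneg _)

section symmetrized

variable {R M : Matrix (Fin n) (Fin n) ℂ}

theorem conjTranspose_mulVec_eq_zero_of_symmetrized (hM : M.PosSemidef)
    (hker : ∀ v, M *ᵥ v = 0 → (Rᴴ * R) *ᵥ v = 0) {u : Fin n → ℂ}
    (hu : (R * M * Rᴴ) *ᵥ u = 0) : Rᴴ *ᵥ u = 0 := by
  have h1 : star (Rᴴ *ᵥ u) ⬝ᵥ (M *ᵥ (Rᴴ *ᵥ u)) = 0 := by
    rw [star_mulVec, conjTranspose_conjTranspose, ← dotProduct_mulVec, mulVec_mulVec,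
      mulVec_mulVec, hu, dotProduct_zero]
  have h2 := hker _ ((hM.dotProduct_mulVec_zero_iff _).1 h1)
  rw [conjTranspose_mul_self_mulVec_eq_zero, mulVec_mulVec,
    self_mul_conjTranspose_mulVec_eq_zero] at h2
  exact h2

/-- `R M Rᴴ` and `Rᴴ` have the same kernel; hence the exponent `rank A` counts the positive
eigenvalues of `R M Rᴴ`. -/
theorem rank_symmetrized (hM : M.PosSemidef) (hker : ∀ v, M *ᵥ v = 0 → (Rᴴ * R) *ᵥ v = 0) :
    (R * M * Rᴴ).rank = (Rᴴ * R).rank := by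
  rw [rank_conjTranspose_mul_self, ← rank_conjTranspose R]
  have hkers : LinearMap.ker (R * M * Rᴴ).mulVecLin = LinearMap.ker Rᴴ.mulVecLin := by
    ext u
    simp only [LinearMap.mem_ker, mulVecLin_apply]
    refine ⟨conjTranspose_mulVec_eq_zero_of_symmetrized hM hker, fun h => ?_⟩
    rw [← mulVec_mulVec, h, mulVec_zero]
  have h1 := (R * M * Rᴴ).mulVecLin.finrank_range_add_finrank_ker
  have h2 := Rᴴ.mulVecLin.finrank_range_add_finrank_ker
  rw [hkers] at h1
  exact Nat.add_right_cancel (h1.trans h2.symm)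

/-- Moving `Rᴴ` cyclically preserves the characteristic polynomial, hence the positive eigenvalues
with multiplicity. -/
theorem vol_eq_prod (hB : (R * M * Rᴴ).IsHermitian) :
    vol (Rᴴ * R * M) = ∏ i with 0 < hB.eigenvalues i, hB.eigenvalues i := by
  classical
  have h : (Rᴴ * R * M).charpoly = (R * M * Rᴴ).charpoly := by
    rw [Matrix.mul_assoc, charpoly_mul_comm]
  rw [vol, h, hB.roots_charpoly_eq_eigenvalues, Multiset.filter_map, Multiset.map_map,
    Finset.prod, Finset.filter_val]
  simp [Function.comp_def]

theorem card_pos_eigenvalues {B : Matrix (Fin n) (Fin n) ℂ} (hB : B.PosSemidef) :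
    ({i | 0 < hB.isHermitian.eigenvalues i} : Finset (Fin n)).card = B.rank := by
  rw [hB.isHermitian.rank_eq_card_non_zero_eigs, Fintype.card_subtype]
  congr 1
  ext i
  simp [(hB.eigenvalues_nonneg i).lt_iff_ne, eq_comm]

theorem trace_re_eq_sum (hB : (R * M * Rᴴ).PosSemidef) :
    (Rᴴ * R * M).trace.re =
      ∑ i with 0 < hB.isHermitian.eigenvalues i, hB.isHermitian.eigenvalues i := by
  rw [Matrix.mul_assoc, trace_mul_comm, hB.isHermitian.trace_eq_sum_eigenvalues,
    Finset.sum_filter_of_ne fun i _ h => lt_of_le_of_ne (hB.eigenvalues_nonneg i) h.symm]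
  simp

end symmetrized

/-! ### The error bound -/

/-- The real number whose image in `ℝ≥0∞` is the Kaporin condition number, for equal ranges. -/
noncomputable def kaporinReal (A Ahat : Matrix (Fin n) (Fin n) ℂ) : ℝ :=
  (1 / (A.rank : ℝ) * (A * pinv Ahat).trace.re) ^ A.rank / vol (A * pinv Ahat)

section bound

variable {A Ahat : Matrix (Fin n) (Fin n) ℂ}

theorem pinv_mulVec_eq_zero_iff_of_range_eq (hA : A.IsHermitian) (hAhat : Ahat.IsHermitian)
    (hr : LinearMap.range A.mulVecLin = LinearMap.range Ahat.mulVecLin) (v : Fin n → ℂ) :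
    pinv Ahat *ᵥ v = 0 ↔ A *ᵥ v = 0 := by
  rw [pinv_mulVec_eq_zero_iff hAhat]
  exact ⟨mulVec_eq_zero_of_range_le hA hAhat hr.le, mulVec_eq_zero_of_range_le hAhat hA hr.ge⟩

theorem symmetrized_posSemidef (R : Matrix (Fin n) (Fin n) ℂ) (hAhat : Ahat.PosSemidef) :
    (R * pinv Ahat * Rᴴ).PosSemidef :=
  (pinv_posSemidef hAhat).mul_mul_conjTranspose_same R

theorem kaporinReal_eq {R : Matrix (Fin n) (Fin n) ℂ} (hAhat : Ahat.PosSemidef)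
    (hker : ∀ v, pinv Ahat *ᵥ v = 0 → (Rᴴ * R) *ᵥ v = 0)
    (s : Finset (Fin n)) (l : Fin n → ℝ)
    (hl : l = (symmetrized_posSemidef R hAhat).isHermitian.eigenvalues)
    (hs : s = ({i | 0 < l i} : Finset (Fin n))) :
    kaporinReal (Rᴴ * R) Ahat = (1 / (s.card : ℝ) * ∑ i ∈ s, l i) ^ s.card / ∏ i ∈ s, l i := by
  have hB := symmetrized_posSemidef R hAhat
  rw [kaporinReal, ← rank_symmetrized (pinv_posSemidef hAhat) hker, ← card_pos_eigenvalues hB,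
    trace_re_eq_sum hB, vol_eq_prod hB.isHermitian, hs, hl]

theorem one_le_kaporinReal (hA : A.PosSemidef) (hAhat : Ahat.PosSemidef)
    (hr : LinearMap.range A.mulVecLin = LinearMap.range Ahat.mulVecLin) :
    1 ≤ kaporinReal A Ahat := by
  have hker := pinv_mulVec_eq_zero_iff_of_range_eq hA.isHermitian hAhat.isHermitian hr
  obtain ⟨R, rfl⟩ := exists_conjTranspose_mul_self hA
  rw [kaporinReal_eq hAhat (fun v => (hker v).1) _ _ rfl rfl]
  exact one_le_mean_pow_div_prod fun i hi => (Finset.mem_filter.1 hi).2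

open Polynomial in
/-- The PCG iterate minimizes the error over the Krylov space. -/
theorem weightedNorm_pcg_le_aeval (hA : A.PosSemidef) (hAhat : Ahat.PosSemidef)
    (hr : LinearMap.range A.mulVecLin = LinearMap.range Ahat.mulVecLin) (b x₀ : Fin n → ℂ)
    {t : ℕ} {p : ℝ[X]} (hp : p.natDegree ≤ t) (hp0 : p.eval 0 = 1) :
    weightedNorm A ((pcg A Ahat b x₀ t).x - pinv A *ᵥ b) ^ 2 ≤
      weightedNorm A (aeval (pinv Ahat * A) p *ᵥ (x₀ - pinv A *ᵥ b)) ^ 2 := by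
  have hker := pinv_mulVec_eq_zero_iff_of_range_eq hA.isHermitian hAhat.isHermitian hr
  have hM := pinv_posSemidef hAhat
  have hinj : ∀ v ∈ LinearMap.range (pinv Ahat).mulVecLin, A *ᵥ v = 0 → v = 0 := by
    rintro _ ⟨w, rfl⟩ h
    rw [← hker] at h
    simp only [mulVecLin_apply] at h ⊢
    rw [← dotProduct_star_self_eq_zero, ← star_dotProduct_mulVec hM.isHermitian, h,
      dotProduct_zero]
  have hinv := krylovInvariant_pcg hA hM hinj b x₀ t
  set M := pinv Ahat with hMdef
  set x := (pcg A Ahat b x₀ t).x with hx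
  set xs := pinv A *ᵥ b with hxs
  set z := M *ᵥ (b - A *ᵥ x₀) with hz
  -- The system may be inconsistent, but the part of `b` outside the range of `A` is invisible to
  -- the preconditioner, as `ker A = ker Â⁺`.
  have hres : M *ᵥ (A *ᵥ xs - b) = 0 := (hker _).2 (mulVec_pinv_residual hA.isHermitian b)
  have hMAe : (M * A) *ᵥ (x₀ - xs) = -z := by
    rw [← mulVec_mulVec, hz, ← mulVec_neg]
    have : A *ᵥ (x₀ - xs) = -(b - A *ᵥ x₀) - (A *ᵥ xs - b) := by rw [mulVec_sub]; abel
    rw [this, mulVec_sub, hres, sub_zero]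
  have hpe : aeval (M * A) p *ᵥ (x₀ - xs) - (x₀ - xs) ∈ krylov (M * A) z t := by
    -- As `p(0) = 1`, `p - 1` is divisible by `X`, and `M A` sends the initial error to `-z`.
    have h1 : aeval (M * A) p = aeval (M * A) p.divX * (M * A) + 1 := by
      conv_lhs => rw [← p.divX_mul_X_add]
      rw [map_add, map_mul, aeval_X, aeval_C, coeff_zero_eq_eval_zero, hp0, map_one]
    rw [h1, add_mulVec, one_mulVec, add_sub_cancel_right, ← mulVec_mulVec, hMAe, mulVec_neg]
    refine neg_mem ?_
    rcases Nat.eq_zero_or_pos p.natDegree with h0 | h0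
    · rw [eq_C_of_natDegree_eq_zero h0, divX_C, map_zero, zero_mulVec]
      exact zero_mem _
    · refine aeval_mulVec_mem_krylov ?_
      rw [natDegree_divX_eq_natDegree_tsub_one]
      omega
  have hMrange : ∀ s, krylov (M * A) z s ≤ LinearMap.range M.mulVecLin := by
    intro s
    cases s with
    | zero => exact bot_le
    | succ s =>
      refine krylov_succ_le ⟨_, rfl⟩ fun v _ => ⟨A *ᵥ v, ?_⟩
      rw [mulVecLin_apply, mulVec_mulVec]
  have horth : ∀ v ∈ krylov (M * A) z t, star v ⬝ᵥ (A *ᵥ (x - xs)) = 0 := by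
    intro v hv
    have h1 := hinv.orthogonal v hv
    rw [pcg_r_eq, ← hx] at h1
    obtain ⟨w, rfl⟩ := hMrange t hv
    have h2 : A *ᵥ (x - xs) = -(b - A *ᵥ x) - (A *ᵥ xs - b) := by rw [mulVec_sub]; abel
    rw [h2, dotProduct_sub, dotProduct_neg, h1, mulVecLin_apply,
      ← star_dotProduct_mulVec hM.isHermitian, hres, dotProduct_zero, neg_zero, sub_zero]
  set w := aeval (M * A) p *ᵥ (x₀ - xs) - (x₀ - xs) - (x - x₀) with hw
  have hwK : w ∈ krylov (M * A) z t := sub_mem hpe hinv.x_mem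
  have hsum : aeval (M * A) p *ᵥ (x₀ - xs) = (x - xs) + w := by rw [hw]; abel
  rw [hsum]
  exact weightedNorm_sq_add hA (horth w hwK)

theorem weightedNorm_pcg_sq_le (hA : A.PosSemidef) (hAhat : Ahat.PosSemidef)
    (hr : LinearMap.range A.mulVecLin = LinearMap.range Ahat.mulVecLin) (b x₀ : Fin n → ℂ)
    {t : ℕ} (ht : 0 < t) :
    weightedNorm A ((pcg A Ahat b x₀ t).x - pinv A *ᵥ b) ^ 2 ≤
      (3 * Real.log (kaporinReal A Ahat) / t) ^ t *
        weightedNorm A (x₀ - pinv A *ᵥ b) ^ 2 := by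
  have hker := pinv_mulVec_eq_zero_iff_of_range_eq hA.isHermitian hAhat.isHermitian hr
  obtain ⟨R, hR⟩ := exists_conjTranspose_mul_self hA
  have hB := symmetrized_posSemidef R hAhat
  have hker' : ∀ v, pinv Ahat *ᵥ v = 0 → (Rᴴ * R) *ᵥ v = 0 := fun v h => hR ▸ (hker v).1 h
  obtain ⟨p, hdeg, hp0, hp⟩ := exists_polynomial_sq_le_log
    (s := ({i | 0 < hB.isHermitian.eigenvalues i} : Finset (Fin n)))
    (l := hB.isHermitian.eigenvalues) (fun i hi => (Finset.mem_filter.1 hi).2) ht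
  rw [← kaporinReal_eq hAhat hker' _ _ rfl rfl, ← hR] at hp
  refine (weightedNorm_pcg_le_aeval hA hAhat hr b x₀ hdeg hp0).trans ?_
  have hsemi : R * (pinv Ahat * A) = R * pinv Ahat * Rᴴ * R := by
    rw [hR]; simp only [Matrix.mul_assoc]
  have hwn : ∀ v, weightedNorm A v ^ 2 = ‖WithLp.toLp 2 (R *ᵥ v)‖ ^ 2 := fun v => by
    rw [hR, weightedNorm_sq]
  rw [hwn, hwn, mulVec_mulVec, mul_aeval_of_semiconj hsemi, ← mulVec_mulVec]
  refine norm_aeval_mulVec_sq_le hB.isHermitian p _ fun i => ?_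
  rcases (hB.eigenvalues_nonneg i).lt_or_eq with h | h
  · exact Or.inl (hp i (Finset.mem_filter.2 ⟨Finset.mem_univ _, h⟩))
  · right
    -- A null eigenvector of `B` is killed by `Rᴴ`, hence orthogonal to the range of `R`, which
    -- contains `R (x₀ - x⋆)`.
    have hu : (R * pinv Ahat * Rᴴ) *ᵥ (hB.isHermitian.eigenvectorBasis i : Fin n → ℂ) = 0 := by
      rw [hB.isHermitian.mulVec_eigenvectorBasis, ← h, zero_smul]
    have := conjTranspose_mulVec_eq_zero_of_symmetrized (pinv_posSemidef hAhat) hker' hu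
    have h2 := congrArg star this
    rw [star_mulVec, conjTranspose_conjTranspose, star_zero] at h2
    rw [dotProduct_mulVec, h2, zero_dotProduct]

end bound

end KaporinPCG

theorem mainTheorem3 (n : ℕ) (A Ahat : Matrix (Fin n) (Fin n) ℂ) (hA : A.PosSemidef)
    (hAhat : Ahat.PosSemidef) (b x₀ : Fin n → ℂ) :
    KaporinPCG.IsMinNormLeastSquaresSolution A b (KaporinPCG.pinv A *ᵥ b) ∧
      ∀ t : ℕ,
        ((ENNReal.ofReal (KaporinPCG.weightedNorm A
              ((KaporinPCG.pcg A Ahat b x₀ t).x - KaporinPCG.pinv A *ᵥ b) ^ 2) /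
            ENNReal.ofReal (KaporinPCG.weightedNorm A
              (x₀ - KaporinPCG.pinv A *ᵥ b) ^ 2) : ℝ≥0∞) : EReal) ≤
          (3 * ENNReal.log (KaporinPCG.kaporin A Ahat) / (t : EReal)) ^ t := by
  refine ⟨KaporinPCG.isMinNormLeastSquaresSolution_pinv hA.isHermitian b, fun t => ?_⟩
  rcases Nat.eq_zero_or_pos t with rfl | ht
  · rw [pow_zero, ← EReal.coe_ennreal_one, EReal.coe_ennreal_le_coe_ennreal_iff]
    exact ENNReal.div_self_le_one
  by_cases hr : LinearMap.range A.mulVecLin = LinearMap.range Ahat.mulVecLin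
  · have hk := KaporinPCG.one_le_kaporinReal hA hAhat hr
    have hkap : KaporinPCG.kaporin A Ahat = ENNReal.ofReal (KaporinPCG.kaporinReal A Ahat) :=
      if_pos hr
    have hc : 0 ≤ (3 * Real.log (KaporinPCG.kaporinReal A Ahat) / t) ^ t := by
      have := Real.log_nonneg hk
      positivity
    have hrhs : (3 * ENNReal.log (KaporinPCG.kaporin A Ahat) / (t : EReal)) ^ t =
        ((ENNReal.ofReal ((3 * Real.log (KaporinPCG.kaporinReal A Ahat) / t) ^ t) : ℝ≥0∞) :
          EReal) := by
      rw [hkap, ENNReal.log_ofReal_of_pos (one_pos.trans_le hk), EReal.coe_ennreal_ofReal,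
        max_eq_left hc, EReal.coe_pow, EReal.coe_div, EReal.coe_mul]
      rfl
    rw [hrhs, EReal.coe_ennreal_le_coe_ennreal_iff]
    -- No positivity of the initial error is needed: if it is 0, the product bound forces the
    -- numerator to be 0, and `0 / 0 = 0`.
    refine ENNReal.div_le_of_le_mul ?_
    rw [← ENNReal.ofReal_mul hc]
    exact ENNReal.ofReal_le_ofReal (KaporinPCG.weightedNorm_pcg_sq_le hA hAhat hr b x₀ ht)
  · have hkap : KaporinPCG.kaporin A Ahat = ⊤ := if_neg hr
    have h3 : (3 : EReal) * ⊤ = ⊤ := EReal.mul_top_of_pos (by norm_num)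
    have htop : ∀ s : ℕ, (⊤ : EReal) ^ (s + 1) = ⊤ := by
      intro s
      induction s with
      | zero => rw [zero_add, pow_one]
      | succ s ih => rw [pow_succ, ih, EReal.top_mul_top]
    obtain ⟨s, rfl⟩ := Nat.exists_eq_add_of_lt ht
    rw [hkap, ENNReal.log_top, h3, EReal.top_div_of_pos_ne_top (by exact_mod_cast ht)
      (EReal.natCast_ne_top _), htop]
    exact le_top
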